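/- Let $d\ge 1$, let $D$ be the open unit ball of $\mathbb{R}^d$ centred at the origin, and let $m$ be Lebesgue measure on $D$. For a unit vector $\nu\in\mathbb{R}^d$ let $H=\{x\in\mathbb{R}^d: x\cdot\nu\ge 0\}$ and $\tau_H x=x-2(x\cdot\nu)\nu$. The polarisation $f_H$ of $f\in L^1_+(D,m)$ is defined (up to $m$-null sets) by \[ f_H(x)=\begin{cases}\min\{f(x),f(\tau_Hx)\}, & x\in D\cap H,\\ \max\{f(x),f(\tau_Hx)\}, & x\in D\setminus H.\end{cases} \] Let $G(x,y)=\Phi(y-x)-\Phi(|x|(y-x^*))$, $x\ne y$ in $D$, be the Green kernel of the Dirichlet Laplacian $-\Delta$ on $D$, where $x^*=x/|x|^2$ and $\Phi$ is the fundamental solution of Laplace's equation in $\mathbb{R}^d$: $\Phi(z)=-|z|/2$ if $d=1$, $\Phi(z)=-\frac1{2\pi}\log|z|$ if $d=2$, and $\Phi(z)=\frac{1}{d(d-2)m(D)}|z|^{2-d}$ if $d\ge3$ (for $x=0$ the second term is $\Phi(e)$ with $|e|=1$). For $f\in L^1_+(D,m)$ put \[ J(f)=(f,Gf)=\int_D\int_D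 f(x)\,G(x,y)\,f(y)\,m(dy)\,m(dx)\in[0,\infty]. \] Then, for every $f\in L^1_+(D,m)$ and every such $H$, $J(f)\le J(f_H)$. If $f=f_H$ $m$-a.e. on $D$ or $f\circ\tau_H=f_H$ $m$-a.e. on $D$, then $J(f)=J(f_H)$. Conversely, if $J(f)<\infty$ and $J(f)=J(f_H)$, then $f=f_H$ $m$-a.e. on $D$ or $f\circ\tau_H=f_H$ $m$-a.e. on $D$. -/

import Mathlib

open MeasureTheory

noncomputable section

namespace BallPolarisation

/-- The open unit ball `D` of `ℝ^d`, centred at the origin. -/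
def unitBall (d : ℕ) : Set (EuclideanSpace ℝ (Fin d)) := Metric.ball 0 1

/-- Lebesgue measure `m` on the unit ball `D`. -/
def ballMeasure (d : ℕ) : Measure (EuclideanSpace ℝ (Fin d)) := volume.restrict (unitBall d)

/-- The closed half-space `H_ν = {x : x · ν ≥ 0}`. -/
def halfSpace {d : ℕ} (ν : EuclideanSpace ℝ (Fin d)) : Set (EuclideanSpace ℝ (Fin d)) :=
  {x | 0 ≤ inner ℝ x ν}

/-- The reflection `τ_H x = x - 2 (x · ν) ν` associated with `H = H_ν` (for a unit vector `ν`). -/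
def reflect {d : ℕ} (ν x : EuclideanSpace ℝ (Fin d)) : EuclideanSpace ℝ (Fin d) :=
  x - (2 * inner ℝ x ν) • ν

open Classical in
/-- The polarisation `f_H`, `H = H_ν`: the smaller of the values `f x`, `f (τ_H x)` on `H`,
the larger one off `H`. Only its values on `D` are used. -/
def polarise {d : ℕ} (ν : EuclideanSpace ℝ (Fin d)) (f : EuclideanSpace ℝ (Fin d) → ℝ)
    (x : EuclideanSpace ℝ (Fin d)) : ℝ :=
  if x ∈ halfSpace ν then min (f x) (f (reflect ν x)) else max (f x) (f (reflect ν x))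

/-- The radial profile of the fundamental solution `Φ` of Laplace's equation in `ℝ^d`, that is
`Φ z = fundProfile d ‖z‖`, normalised by `-ΔΦ = δ₀`. -/
def fundProfile (d : ℕ) (r : ℝ) : ℝ :=
  if d = 1 then -(r / 2)
  else if d = 2 then -(1 / (2 * Real.pi)) * Real.log r
  else 1 / ((d : ℝ) * ((d : ℝ) - 2) * (volume (unitBall d)).toReal) * (r ^ (d - 2))⁻¹

open Classical in
/-- The Green kernel `G(x, y) = Φ(y - x) - Φ(|x| (y - x*))` of the Dirichlet Laplacian `-Δ` on the
unit ball, where `x* = x / |x|²` is the inversion of `x` in the unit sphere. At `x = 0`, where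
`x*` is not defined, `|x| (y - x*)` is read as a vector of norm `1`, which is the limit as `x → 0`
of its norm. For `d ≥ 2` the values on the diagonal (a null set) are irrelevant. -/
def greenKernel {d : ℕ} (x y : EuclideanSpace ℝ (Fin d)) : ℝ :=
  fundProfile d ‖y - x‖ -
    (if x = 0 then fundProfile d 1
     else fundProfile d ‖‖x‖ • (y - EuclideanGeometry.inversion 0 1 x)‖)

/-- `(G f)(x) = ∫_D G(x, y) f(y) m(dy)` in `[0, ∞]`, for nonnegative `f`. The kernel is
nonnegative off the diagonal of `D × D`. -/
def greenPotential {d : ℕ} (f : EuclideanSpace ℝ (Fin d) → ℝ) (x : EuclideanSpace ℝ (Fin d)) :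
    ENNReal :=
  ∫⁻ y, ENNReal.ofReal (greenKernel x y) * ENNReal.ofReal (f y) ∂(ballMeasure d)

/-- `J f = (f, G f) = ∫_D f(x) (G f)(x) m(dx)` in `[0, ∞]`, for nonnegative `f`. -/
def J {d : ℕ} (f : EuclideanSpace ℝ (Fin d) → ℝ) : ENNReal :=
  ∫⁻ x, ENNReal.ofReal (f x) * greenPotential f x ∂(ballMeasure d)

end BallPolarisation

end

namespace BallPolarisation

/-! ### Reflection and polarisation -/

section Reflection

variable {d : ℕ} {ν : EuclideanSpace ℝ (Fin d)}

/-! On `D` the Green kernel depends only on `|y - x|` and on the reflection-invariant `p = (1 -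
|x|²)(1 - |y|²)`; it is positive and strictly decreasing in `|y - x|` (`greenProfile_pos_and_lt`).
Hence `G(x, y) > G(x, τy) > 0` for distinct `x, y` strictly on the same side of the hyperplane.

Averaging over the reflections of `x` and `y` writes `4 J f` as the integral of a density in which
`G(x, y)` and `G(x, τy)` have coefficients with sum `(f x + f (τx)) (f y + f (τy))`. Polarisation
keeps this sum and moves weight to the larger kernel value (`symmetrisedDensity_polarise`).

If `J f` is finite and unchanged, the densities agree a.e., so `f - f ∘ τ` a.e. does not take
opposite signs at two points of the negative side. The product of `{f > f ∘ τ}` and `{f < f ∘ τ}`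
there is null, so one factor is null. -/

lemma reflect_eq_reflection (hν : ‖ν‖ = 1) :
    reflect ν = ((Submodule.span ℝ {ν})ᗮ.reflection : _ → _) := by
  ext1 x
  rw [Submodule.reflection_orthogonal_apply, Submodule.reflection_singleton_apply, reflect,
    real_inner_comm, hν, neg_sub, ← Nat.cast_smul_eq_nsmul ℝ, smul_smul]
  simp

lemma reflect_reflect (hν : ‖ν‖ = 1) (x : EuclideanSpace ℝ (Fin d)) :
    reflect ν (reflect ν x) = x := by
  rw [reflect_eq_reflection hν, Submodule.reflection_reflection]

lemma norm_reflect (hν : ‖ν‖ = 1) (x : EuclideanSpace ℝ (Fin d)) : ‖reflect ν x‖ = ‖x‖ := by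
  rw [reflect_eq_reflection hν, LinearIsometryEquiv.norm_map]

lemma reflect_sub (x y : EuclideanSpace ℝ (Fin d)) :
    reflect ν (x - y) = reflect ν x - reflect ν y := by
  simp only [reflect, inner_sub_left, mul_sub, sub_smul]
  abel

lemma inner_reflect (hν : ‖ν‖ = 1) (x : EuclideanSpace ℝ (Fin d)) :
    inner ℝ (reflect ν x) ν = -inner ℝ x ν := by
  rw [reflect, inner_sub_left, inner_smul_left, real_inner_self_eq_norm_sq, hν]
  simp
  ring

lemma norm_sub_reflect_sq (hν : ‖ν‖ = 1) (x y : EuclideanSpace ℝ (Fin d)) :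
    ‖reflect ν y - x‖ ^ 2 = ‖y - x‖ ^ 2 + 4 * (inner ℝ x ν * inner ℝ y ν) := by
  rw [@norm_sub_sq_real, @norm_sub_sq_real, norm_reflect hν, reflect, inner_sub_left,
    inner_smul_left, real_inner_comm x ν]
  simp
  ring

lemma measurable_reflect : Measurable (reflect ν) := by
  unfold reflect
  fun_prop

lemma measurableSet_unitBall : MeasurableSet (unitBall d) := measurableSet_ball

lemma reflect_mem_unitBall (hν : ‖ν‖ = 1) {x : EuclideanSpace ℝ (Fin d)} :
    reflect ν x ∈ unitBall d ↔ x ∈ unitBall d := by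
  simp [unitBall, norm_reflect hν]

lemma measurePreserving_reflect (hν : ‖ν‖ = 1) :
    MeasurePreserving (reflect ν) (ballMeasure d) (ballMeasure d) := by
  have h : MeasurePreserving (reflect ν) volume volume := by
    rw [reflect_eq_reflection hν]
    exact LinearIsometryEquiv.measurePreserving _
  have h' := h.restrict_preimage (measurableSet_unitBall (d := d))
  rwa [show reflect ν ⁻¹' unitBall d = unitBall d from
    Set.ext fun x => reflect_mem_unitBall hν] at h'

lemma ae_ballMeasure_inner_ne_zero (hν : ‖ν‖ = 1) :
    ∀ᵐ x ∂(ballMeasure d), inner ℝ x ν ≠ 0 := by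
  refine ae_restrict_of_ae ?_
  have hne : (Submodule.span ℝ {ν})ᗮ ≠ ⊤ := by
    intro h
    have : ν ∈ (Submodule.span ℝ {ν})ᗮ := h ▸ Submodule.mem_top
    rw [Submodule.mem_orthogonal_singleton_iff_inner_left, real_inner_self_eq_norm_sq, hν] at this
    norm_num at this
  have h0 := Measure.addHaar_submodule (volume : Measure (EuclideanSpace ℝ (Fin d))) _ hne
  rw [ae_iff]
  convert h0 using 2
  ext x
  simp [Submodule.mem_orthogonal_singleton_iff_inner_left]

lemma polarise_of_neg {x : EuclideanSpace ℝ (Fin d)} (h : inner ℝ x ν < 0)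
    (f : EuclideanSpace ℝ (Fin d) → ℝ) : polarise ν f x = max (f x) (f (reflect ν x)) := by
  simp [polarise, halfSpace, h.not_ge]

lemma polarise_of_pos {x : EuclideanSpace ℝ (Fin d)} (h : 0 < inner ℝ x ν)
    (f : EuclideanSpace ℝ (Fin d) → ℝ) : polarise ν f x = min (f x) (f (reflect ν x)) := by
  simp [polarise, halfSpace, h.le]

lemma polarise_reflect_of_neg (hν : ‖ν‖ = 1) {x : EuclideanSpace ℝ (Fin d)}
    (h : inner ℝ x ν < 0) (f : EuclideanSpace ℝ (Fin d) → ℝ) :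
    polarise ν f (reflect ν x) = min (f x) (f (reflect ν x)) := by
  rw [polarise_of_pos (by rw [inner_reflect hν]; linarith), reflect_reflect hν, min_comm]

lemma polarise_reflect_of_pos (hν : ‖ν‖ = 1) {x : EuclideanSpace ℝ (Fin d)}
    (h : 0 < inner ℝ x ν) (f : EuclideanSpace ℝ (Fin d) → ℝ) :
    polarise ν f (reflect ν x) = max (f x) (f (reflect ν x)) := by
  rw [polarise_of_neg (by rw [inner_reflect hν]; linarith), reflect_reflect hν, max_comm]

lemma measurable_polarise {f : EuclideanSpace ℝ (Fin d) → ℝ} (hf : Measurable f) :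
    Measurable (polarise ν f) := by
  have hτ := hf.comp (measurable_reflect (ν := ν))
  refine Measurable.ite ?_ (hf.min hτ) (hf.max hτ)
  have hi : Measurable fun x : EuclideanSpace ℝ (Fin d) => inner ℝ x ν := by fun_prop
  exact measurableSet_le measurable_const hi

lemma polarise_congr_ae (hν : ‖ν‖ = 1) {f g : EuclideanSpace ℝ (Fin d) → ℝ}
    (h : f =ᵐ[ballMeasure d] g) : polarise ν f =ᵐ[ballMeasure d] polarise ν g := by
  filter_upwards [h, (measurePreserving_reflect hν).quasiMeasurePreserving.ae h] with x h1 h2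
  simp only [polarise, h1, h2]

end Reflection

/-! ### The Green kernel -/

/-- The Green kernel as a function of `r = |y - x|` and `p = (1 - |x|²) (1 - |y|²)`. -/
noncomputable def greenProfile (d : ℕ) (p r : ℝ) : ℝ :=
  fundProfile d r - fundProfile d √(r ^ 2 + p)

/-- Rests on `|x|² |y - x*|² = |y - x|² + (1 - |x|²)(1 - |y|²)`; at `x = 0` the right side is `1`,
matching the convention there. -/
lemma greenKernel_eq_greenProfile {d : ℕ} (x y : EuclideanSpace ℝ (Fin d)) :
    greenKernel x y = greenProfile d ((1 - ‖x‖ ^ 2) * (1 - ‖y‖ ^ 2)) ‖y - x‖ := by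
  unfold greenKernel greenProfile
  congr 1
  split_ifs with hx
  · subst hx
    simp
  · congr 1
    have hx' : ‖x‖ ≠ 0 := norm_ne_zero_iff.mpr hx
    rw [eq_comm, Real.sqrt_eq_iff_eq_sq ?_ (norm_nonneg _)]
    · rw [norm_smul, norm_norm, mul_pow, EuclideanGeometry.inversion]
      simp only [dist_zero_right, vsub_eq_sub, sub_zero, vadd_eq_add, add_zero]
      rw [@norm_sub_sq_real, @norm_sub_sq_real, norm_smul, inner_smul_right]
      simp only [norm_pow, norm_div, norm_one, norm_norm]
      field_simp
      ring
    -- By Cauchy-Schwarz the radicand is at least `(|x| |y| - 1)²`, even outside the ball.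
    · rw [@norm_sub_sq_real]
      have h1 := real_inner_le_norm y x
      nlinarith [sq_nonneg (‖x‖ * ‖y‖ - 1)]

lemma measurable_fundProfile (d : ℕ) : Measurable (fundProfile d) := by
  unfold fundProfile
  split_ifs <;> fun_prop

lemma measurable_greenKernel {d : ℕ} : Measurable
    fun z : EuclideanSpace ℝ (Fin d) × EuclideanSpace ℝ (Fin d) => greenKernel z.1 z.2 := by
  simp only [greenKernel_eq_greenProfile, greenProfile]
  have := measurable_fundProfile d
  fun_prop

/-- Lifts the comparison of `1/r - 1/r'` (the case `d = 3`) to the exponent `d - 2`. -/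
lemma inv_pow_sub_lt {a a' b b' : ℝ} (hb : 0 < b) (hb' : 0 < b') (hba : b < a)
    (hba' : b' < a') (hbb : b' < b) (h : b - b' < a - a') (n : ℕ) :
    0 < b ^ (n + 1) - b' ^ (n + 1) ∧
      b ^ (n + 1) - b' ^ (n + 1) < a ^ (n + 1) - a' ^ (n + 1) := by
  induction n with
  | zero => simpa using ⟨hbb, h⟩
  | succ n ih =>
    have hp : b' ^ (n + 1) < a' ^ (n + 1) := pow_lt_pow_left₀ hba' hb'.le (by simp)
    have hp' : 0 < b' ^ (n + 1) := by positivity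
    have e : ∀ s t : ℝ, s ^ (n + 1 + 1) - t ^ (n + 1 + 1) =
        s * (s ^ (n + 1) - t ^ (n + 1)) + t ^ (n + 1) * (s - t) := fun s t => by ring
    rw [e, e]
    have h1 := mul_pos hb ih.1
    have h2 := mul_pos hp' (sub_pos.mpr hbb)
    have h3 : b * (b ^ (n + 1) - b' ^ (n + 1)) < a * (a ^ (n + 1) - a' ^ (n + 1)) :=
      mul_lt_mul hba ih.2.le ih.1 (hb.trans hba).le
    have h4 : b' ^ (n + 1) * (b - b') < a' ^ (n + 1) * (a - a') :=
      mul_lt_mul hp h.le (sub_pos.mpr hbb) (hp'.trans hp).le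
    exact ⟨by linarith, by linarith⟩

/-- With `r' = √(r² + p)`, the gap `r' - r = p / (r' + r)` decreases in `r`. This settles `d = 1`,
and gives the monotonicity of `r' / r` for `d = 2` and of `1/r - 1/r'` for `d ≥ 3`. -/
lemma greenProfile_pos_and_lt {d : ℕ} (hd : 1 ≤ d) {p r R : ℝ} (hp : 0 < p) (hr : 0 < r)
    (hrR : r < R) :
    0 < greenProfile d p R ∧ greenProfile d p R < greenProfile d p r := by
  have hR : 0 < R := hr.trans hrR
  unfold greenProfile
  obtain ⟨r', hr'⟩ : ∃ r', r' = √(r ^ 2 + p) := ⟨_, rfl⟩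
  obtain ⟨R', hR'⟩ : ∃ R', R' = √(R ^ 2 + p) := ⟨_, rfl⟩
  have hr2 : r' ^ 2 = r ^ 2 + p := by rw [hr', Real.sq_sqrt (by positivity)]
  have hR2 : R' ^ 2 = R ^ 2 + p := by rw [hR', Real.sq_sqrt (by positivity)]
  have hr0 : 0 < r' := hr' ▸ Real.sqrt_pos.mpr (by positivity)
  have hR0 : 0 < R' := hR' ▸ Real.sqrt_pos.mpr (by positivity)
  rw [← hr', ← hR']
  have hrr : r < r' := lt_of_pow_lt_pow_left₀ 2 hr0.le (by linarith)
  have hRR : R < R' := lt_of_pow_lt_pow_left₀ 2 hR0.le (by linarith)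
  have hrR' : r' < R' := lt_of_pow_lt_pow_left₀ 2 hR0.le (by nlinarith)
  have er : r' - r = p / (r' + r) := by
    rw [eq_div_iff (by positivity)]; linear_combination hr2
  have eR : R' - R = p / (R' + R) := by
    rw [eq_div_iff (by positivity)]; linear_combination hR2
  have hdiff : R' - R < r' - r := by
    rw [er, eR]; exact div_lt_div_of_pos_left hp (by positivity) (by linarith)
  unfold fundProfile
  split_ifs with h1 h2
  · exact ⟨by linarith, by linarith⟩
  · have hc : 0 < 1 / (2 * Real.pi) := by positivity
    have hlog : Real.log R < Real.log R' := Real.log_lt_log hR hRR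
    have hlog' : Real.log R' - Real.log R < Real.log r' - Real.log r := by
      rw [← Real.log_div hR0.ne' hR.ne', ← Real.log_div hr0.ne' hr.ne']
      refine Real.log_lt_log (by positivity) ?_
      rw [div_lt_div_iff₀ hR hr]
      nlinarith
    constructor <;> nlinarith
  · obtain ⟨n, rfl⟩ : ∃ n, d = n + 1 + 2 := ⟨d - 3, by omega⟩
    have hvol : 0 < (volume (unitBall (n + 1 + 2))).toReal :=
      ENNReal.toReal_pos (Metric.measure_ball_pos _ _ one_pos).ne' measure_ball_lt_top.ne
    have hc : 0 < 1 / (((n + 1 + 2 : ℕ) : ℝ) * (((n + 1 + 2 : ℕ) : ℝ) - 2) *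
        (volume (unitBall (n + 1 + 2))).toReal) := by
      have : ((n + 1 + 2 : ℕ) : ℝ) - 2 = n + 1 := by push_cast; ring
      rw [this]
      positivity
    have hinv : R⁻¹ - R'⁻¹ < r⁻¹ - r'⁻¹ := by
      rw [inv_sub_inv hR.ne' hR0.ne', inv_sub_inv hr.ne' hr0.ne']
      exact div_lt_div₀ hdiff (by gcongr) (by linarith) (by positivity)
    have key := inv_pow_sub_lt (inv_pos.mpr hR) (inv_pos.mpr hR0)
      (inv_strictAnti₀ hr hrR) (inv_strictAnti₀ hr0 hrR') (inv_strictAnti₀ hR hRR) hinv n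
    simp only [inv_pow] at key
    rw [Nat.add_sub_cancel, ← mul_sub, ← mul_sub]
    exact ⟨mul_pos hc key.1, mul_lt_mul_of_pos_left key.2 hc⟩

section Kernel

variable {d : ℕ} {ν : EuclideanSpace ℝ (Fin d)}

lemma greenKernel_reflect_reflect (hν : ‖ν‖ = 1) (x y : EuclideanSpace ℝ (Fin d)) :
    greenKernel (reflect ν x) (reflect ν y) = greenKernel x y := by
  rw [greenKernel_eq_greenProfile, greenKernel_eq_greenProfile, ← reflect_sub, norm_reflect hν,
    norm_reflect hν, norm_reflect hν]

lemma greenKernel_reflect_left (hν : ‖ν‖ = 1) (x y : EuclideanSpace ℝ (Fin d)) :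
    greenKernel (reflect ν x) y = greenKernel x (reflect ν y) := by
  rw [← greenKernel_reflect_reflect hν x, reflect_reflect hν]

lemma greenKernel_reflect_lt (hd : 1 ≤ d) (hν : ‖ν‖ = 1) {x y : EuclideanSpace ℝ (Fin d)}
    (hx : x ∈ unitBall d) (hy : y ∈ unitBall d) (hxy : y ≠ x)
    (h : 0 < inner ℝ x ν * inner ℝ y ν) :
    0 < greenKernel x (reflect ν y) ∧ greenKernel x (reflect ν y) < greenKernel x y := by
  have hx' : ‖x‖ < 1 := by simpa [unitBall] using hx
  have hy' : ‖y‖ < 1 := by simpa [unitBall] using hy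
  rw [greenKernel_eq_greenProfile, greenKernel_eq_greenProfile, norm_reflect hν]
  refine greenProfile_pos_and_lt hd ?_ (norm_pos_iff.mpr (sub_ne_zero.mpr hxy)) ?_
  · exact mul_pos (by nlinarith [norm_nonneg x]) (by nlinarith [norm_nonneg y])
  · refine lt_of_pow_lt_pow_left₀ 2 (norm_nonneg _) ?_
    rw [norm_sub_reflect_sq hν]
    linarith

end Kernel

/-! ### Symmetrised energy -/

section Energy

variable {d : ℕ} {ν : EuclideanSpace ℝ (Fin d)}

instance : IsFiniteMeasure (ballMeasure d) :=
  isFiniteMeasure_restrict.mpr measure_ball_lt_top.ne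

lemma ae_mem_unitBall : ∀ᵐ x ∂(ballMeasure d), x ∈ unitBall d :=
  ae_restrict_mem measurableSet_unitBall

lemma ae_ballMeasure_ne (hd : 1 ≤ d) (x : EuclideanSpace ℝ (Fin d)) :
    ∀ᵐ y ∂(ballMeasure d), y ≠ x := by
  have : Nonempty (Fin d) := ⟨⟨0, hd⟩⟩
  refine ae_restrict_of_ae ?_
  rw [ae_iff]
  simp

lemma J_congr_ae {f g : EuclideanSpace ℝ (Fin d) → ℝ} (h : f =ᵐ[ballMeasure d] g) :
    J f = J g := by
  have hG : ∀ x, greenPotential f x = greenPotential g x := fun x =>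
    lintegral_congr_ae (h.mono fun y hy => by simp only [hy])
  exact lintegral_congr_ae (h.mono fun x hx => by simp only [hx, hG])

lemma J_comp_reflect (hν : ‖ν‖ = 1) {f : EuclideanSpace ℝ (Fin d) → ℝ} (hf : Measurable f) :
    J (fun x => f (reflect ν x)) = J f := by
  have hK := measurable_greenKernel (d := d)
  have hτ := measurePreserving_reflect hν
  have hG : ∀ x, greenPotential (fun x => f (reflect ν x)) x
      = greenPotential f (reflect ν x) := fun x => by
    have h := hτ.lintegral_comp (f := fun y =>
      ENNReal.ofReal (greenKernel (reflect ν x) y) * ENNReal.ofReal (f y)) (by fun_prop)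
    simp only [greenKernel_reflect_reflect hν] at h
    exact h
  simp only [J, hG]
  refine hτ.lintegral_comp (f := fun x => ENNReal.ofReal (f x) * greenPotential f x) ?_
  refine hf.ennreal_ofReal.mul (Measurable.lintegral_prod_right' (f := fun z =>
    ENNReal.ofReal (greenKernel z.1 z.2) * ENNReal.ofReal (f z.2)) ?_)
  fun_prop

/-- The sum of the energy densities of `f` at the four pairs obtained from `z` by applying the
reflection to its components. -/
noncomputable def symmetrisedDensity (ν : EuclideanSpace ℝ (Fin d))
    (f : EuclideanSpace ℝ (Fin d) → ℝ)
    (z : EuclideanSpace ℝ (Fin d) × EuclideanSpace ℝ (Fin d)) : ℝ :=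
  (f z.1 * f z.2 + f (reflect ν z.1) * f (reflect ν z.2)) * max (greenKernel z.1 z.2) 0 +
  (f z.1 * f (reflect ν z.2) + f (reflect ν z.1) * f z.2) *
    max (greenKernel z.1 (reflect ν z.2)) 0

lemma symmetrisedDensity_nonneg {f : EuclideanSpace ℝ (Fin d) → ℝ} (hf : ∀ x, 0 ≤ f x)
    (z : EuclideanSpace ℝ (Fin d) × EuclideanSpace ℝ (Fin d)) :
    0 ≤ symmetrisedDensity ν f z := by
  have := hf z.1
  have := hf z.2
  have := hf (reflect ν z.1)
  have := hf (reflect ν z.2)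
  unfold symmetrisedDensity
  positivity

lemma measurable_greenKernel_reflect :
    Measurable fun z : EuclideanSpace ℝ (Fin d) × EuclideanSpace ℝ (Fin d) =>
      greenKernel z.1 (reflect ν z.2) := by
  have hφ := measurable_fundProfile d
  have hτ : Measurable fun z : EuclideanSpace ℝ (Fin d) × EuclideanSpace ℝ (Fin d) =>
    reflect ν z.2 := measurable_reflect.comp measurable_snd
  simp only [greenKernel_eq_greenProfile, greenProfile]
  fun_prop

lemma measurable_symmetrisedDensity {f : EuclideanSpace ℝ (Fin d) → ℝ} (hf : Measurable f) :
    Measurable (symmetrisedDensity ν f) := by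
  have hK := measurable_greenKernel (d := d)
  have hK' := measurable_greenKernel_reflect (ν := ν)
  have hτ : Measurable fun x => f (reflect ν x) := hf.comp measurable_reflect
  have key : ∀ g k k' : _ → ℝ, Measurable g → Measurable k → Measurable k' →
      Measurable fun z : EuclideanSpace ℝ (Fin d) × EuclideanSpace ℝ (Fin d) =>
        (f z.1 * f z.2 + g z.1 * g z.2) * max (k z) 0 +
          (f z.1 * g z.2 + g z.1 * f z.2) * max (k' z) 0 := by
    intro g k k' _ _ _
    fun_prop
  exact key _ _ _ hτ hK hK'

/-- The `max` with `0` is the truncation that `ENNReal.ofReal` applies to the kernel. -/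
lemma J_eq_lintegral_prod {f : EuclideanSpace ℝ (Fin d) → ℝ} (hf : Measurable f)
    (hf0 : ∀ x, 0 ≤ f x) :
    J f = ∫⁻ z, ENNReal.ofReal (f z.1 * f z.2 * max (greenKernel z.1 z.2) 0)
      ∂((ballMeasure d).prod (ballMeasure d)) := by
  have hK := measurable_greenKernel (d := d)
  rw [lintegral_prod _ (by fun_prop)]
  refine lintegral_congr fun x => ?_
  rw [greenPotential, ← lintegral_const_mul _ (by fun_prop)]
  refine lintegral_congr fun y => ?_
  rw [ENNReal.ofReal_mul (mul_nonneg (hf0 x) (hf0 y)), ENNReal.ofReal_mul (hf0 x),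
    ENNReal.ofReal_max, ENNReal.ofReal_zero, max_eq_left zero_le, mul_assoc,
    mul_comm (ENNReal.ofReal (f y))]

lemma lintegral_add_reflect (hν : ‖ν‖ = 1)
    {q : EuclideanSpace ℝ (Fin d) × EuclideanSpace ℝ (Fin d) → ENNReal} (hq : Measurable q) :
    ∫⁻ z, (q z + q (Prod.map (reflect ν) (reflect ν) z) + q (Prod.map id (reflect ν) z) +
      q (Prod.map (reflect ν) id z)) ∂((ballMeasure d).prod (ballMeasure d)) =
    4 * ∫⁻ z, q z ∂((ballMeasure d).prod (ballMeasure d)) := by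
  have hτ := measurePreserving_reflect hν
  have hid := MeasurePreserving.id (ballMeasure d)
  have m1 : Measurable fun z => q (Prod.map (reflect ν) (reflect ν) z) :=
    hq.comp (hτ.prod hτ).measurable
  have m2 : Measurable fun z => q (Prod.map id (reflect ν) z) := hq.comp (hid.prod hτ).measurable
  have m3 : Measurable fun z => q (Prod.map (reflect ν) id z) := hq.comp (hτ.prod hid).measurable
  rw [lintegral_add_right _ m3, lintegral_add_right _ m2, lintegral_add_right _ m1,
    (hτ.prod hτ).lintegral_comp hq, (hid.prod hτ).lintegral_comp hq,
    (hτ.prod hid).lintegral_comp hq]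
  ring

lemma lintegral_symmetrisedDensity (hν : ‖ν‖ = 1) {f : EuclideanSpace ℝ (Fin d) → ℝ}
    (hf : Measurable f) (hf0 : ∀ x, 0 ≤ f x) :
    ∫⁻ z, ENNReal.ofReal (symmetrisedDensity ν f z)
      ∂((ballMeasure d).prod (ballMeasure d)) = 4 * J f := by
  have hK := measurable_greenKernel (d := d)
  rw [J_eq_lintegral_prod hf hf0, ← lintegral_add_reflect hν (by fun_prop)]
  refine lintegral_congr fun z => ?_
  have := hf0 z.1
  have := hf0 z.2
  have := hf0 (reflect ν z.1)
  have := hf0 (reflect ν z.2)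
  simp only [Prod.map_fst, Prod.map_snd, id_eq, greenKernel_reflect_reflect hν,
    greenKernel_reflect_left hν]
  rw [← ENNReal.ofReal_add (by positivity) (by positivity),
    ← ENNReal.ofReal_add (by positivity) (by positivity),
    ← ENNReal.ofReal_add (by positivity) (by positivity), symmetrisedDensity]
  congr 1
  ring

/-- Polarising does not decrease the symmetrised density, and increases it strictly where `f` and
its reflection are ordered in opposite ways at the two points. -/
lemma symmetrisedDensity_polarise (hd : 1 ≤ d) (hν : ‖ν‖ = 1)
    (f : EuclideanSpace ℝ (Fin d) → ℝ)
    {z : EuclideanSpace ℝ (Fin d) × EuclideanSpace ℝ (Fin d)}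
    (h1 : z.1 ∈ unitBall d) (h2 : z.2 ∈ unitBall d) (hne : z.2 ≠ z.1)
    (hne' : z.2 ≠ reflect ν z.1) (hz1 : inner ℝ z.1 ν ≠ 0) (hz2 : inner ℝ z.2 ν ≠ 0) :
    symmetrisedDensity ν f z ≤ symmetrisedDensity ν (polarise ν f) z ∧
    (inner ℝ z.1 ν < 0 → inner ℝ z.2 ν < 0 →
      symmetrisedDensity ν f z = symmetrisedDensity ν (polarise ν f) z →
      0 ≤ (f z.1 - f (reflect ν z.1)) * (f z.2 - f (reflect ν z.2))) := by
  obtain ⟨x, y⟩ := z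
  dsimp only at *
  have same : 0 < inner ℝ x ν * inner ℝ y ν →
      max (greenKernel x (reflect ν y)) 0 < max (greenKernel x y) 0 := fun h => by
    obtain ⟨k1, k2⟩ := greenKernel_reflect_lt hd hν h1 h2 hne h
    rwa [max_eq_left k1.le, max_eq_left (k1.trans k2).le]
  have opp : inner ℝ x ν * inner ℝ y ν < 0 →
      -- Here `τy` lies on the side of `x`, so the same-side comparison applies to `x` and `τy`.
      max (greenKernel x y) 0 < max (greenKernel x (reflect ν y)) 0 := fun h => by
    obtain ⟨k1, k2⟩ := greenKernel_reflect_lt hd hν h1 ((reflect_mem_unitBall hν).mpr h2)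
      (fun h' => hne' (by rw [← h', reflect_reflect hν]))
      (by rw [inner_reflect hν]; linarith)
    rw [reflect_reflect hν] at k1 k2
    rwa [max_eq_left k1.le, max_eq_left (k1.trans k2).le]
  unfold symmetrisedDensity
  dsimp only
  generalize max (greenKernel x y) 0 = k at *
  generalize max (greenKernel x (reflect ν y)) 0 = k' at *
  rcases lt_or_gt_of_ne hz1 with hx | hx <;> rcases lt_or_gt_of_ne hz2 with hy | hy
  · have hk := same (mul_pos_of_neg_of_neg hx hy)
    rw [polarise_of_neg hx, polarise_of_neg hy, polarise_reflect_of_neg hν hx,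
      polarise_reflect_of_neg hν hy]
    generalize f x = a, f (reflect ν x) = b, f y = c, f (reflect ν y) = e
    -- If the two pairs are ordered alike, the density is unchanged; otherwise it gains `-(a - b)(c
    -- - e)(k - k') ≥ 0`, and zero gain forces `(a - b)(c - e) = 0`.
    rcases le_total a b with hab | hab <;> rcases le_total c e with hce | hce <;>
      simp only [max_eq_left, max_eq_right, min_eq_left, min_eq_right, hab, hce]
    · exact ⟨by linarith, fun _ _ _ => by nlinarith⟩
    · have hq := mul_nonneg (mul_nonneg (sub_nonneg.mpr hab) (sub_nonneg.mpr hce))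
        (sub_nonneg.mpr hk.le)
      refine ⟨by linarith, fun _ _ h => ?_⟩
      have h0 : ((a - b) * (c - e)) * (k - k') = 0 := by linear_combination h
      exact ((mul_eq_zero.mp h0).resolve_right (by linarith)).ge
    · have hq := mul_nonneg (mul_nonneg (sub_nonneg.mpr hab) (sub_nonneg.mpr hce))
        (sub_nonneg.mpr hk.le)
      refine ⟨by linarith, fun _ _ h => ?_⟩
      have h0 : ((a - b) * (c - e)) * (k - k') = 0 := by linear_combination h
      exact ((mul_eq_zero.mp h0).resolve_right (by linarith)).ge
    · exact ⟨by linarith, fun _ _ _ => by nlinarith⟩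
  · refine ⟨?_, fun _ h => absurd h hy.not_gt⟩
    have hk := opp (mul_neg_of_neg_of_pos hx hy)
    rw [polarise_of_neg hx, polarise_of_pos hy, polarise_reflect_of_neg hν hx,
      polarise_reflect_of_pos hν hy]
    generalize f x = a, f (reflect ν x) = b, f y = c, f (reflect ν y) = e
    rcases le_total a b with hab | hab <;> rcases le_total c e with hce | hce <;>
      simp only [max_eq_left, max_eq_right, min_eq_left, min_eq_right, hab, hce] <;>
      nlinarith [mul_nonneg (mul_nonneg (sub_nonneg.mpr hab) (sub_nonneg.mpr hce))
        (sub_nonneg.mpr hk.le)]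
  · refine ⟨?_, fun h => absurd h hx.not_gt⟩
    have hk := opp (mul_neg_of_pos_of_neg hx hy)
    rw [polarise_of_pos hx, polarise_of_neg hy, polarise_reflect_of_pos hν hx,
      polarise_reflect_of_neg hν hy]
    generalize f x = a, f (reflect ν x) = b, f y = c, f (reflect ν y) = e
    rcases le_total a b with hab | hab <;> rcases le_total c e with hce | hce <;>
      simp only [max_eq_left, max_eq_right, min_eq_left, min_eq_right, hab, hce] <;>
      nlinarith [mul_nonneg (mul_nonneg (sub_nonneg.mpr hab) (sub_nonneg.mpr hce))
        (sub_nonneg.mpr hk.le)]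
  · refine ⟨?_, fun h => absurd h hx.not_gt⟩
    have hk := same (mul_pos hx hy)
    rw [polarise_of_pos hx, polarise_of_pos hy, polarise_reflect_of_pos hν hx,
      polarise_reflect_of_pos hν hy]
    generalize f x = a, f (reflect ν x) = b, f y = c, f (reflect ν y) = e
    rcases le_total a b with hab | hab <;> rcases le_total c e with hce | hce <;>
      simp only [max_eq_left, max_eq_right, min_eq_left, min_eq_right, hab, hce] <;>
      nlinarith [mul_nonneg (mul_nonneg (sub_nonneg.mpr hab) (sub_nonneg.mpr hce))
        (sub_nonneg.mpr hk.le)]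

lemma ae_symmetrisedDensity_polarise (hd : 1 ≤ d) (hν : ‖ν‖ = 1)
    (f : EuclideanSpace ℝ (Fin d) → ℝ) :
    ∀ᵐ z ∂((ballMeasure d).prod (ballMeasure d)),
      symmetrisedDensity ν f z ≤ symmetrisedDensity ν (polarise ν f) z ∧
      (inner ℝ z.1 ν < 0 → inner ℝ z.2 ν < 0 →
        symmetrisedDensity ν f z = symmetrisedDensity ν (polarise ν f) z →
        0 ≤ (f z.1 - f (reflect ν z.1)) * (f z.2 - f (reflect ν z.2))) := by
  have hτ := measurable_reflect (ν := ν)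
  have hdiag : ∀ᵐ z ∂((ballMeasure d).prod (ballMeasure d)), z.2 ≠ z.1 :=
    (Measure.ae_prod_iff_ae_ae (measurableSet_eq_fun measurable_snd measurable_fst).compl).mpr
      (.of_forall fun x => ae_ballMeasure_ne hd x)
  have hdiag' : ∀ᵐ z ∂((ballMeasure d).prod (ballMeasure d)), z.2 ≠ reflect ν z.1 :=
    (Measure.ae_prod_iff_ae_ae (p := fun z => z.2 ≠ reflect ν z.1)
      (measurableSet_eq_fun measurable_snd (hτ.comp measurable_fst)).compl).mpr (.of_forall fun x => ae_ballMeasure_ne hd (reflect ν x))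
  filter_upwards [hdiag, hdiag',
    Measure.quasiMeasurePreserving_fst.ae ae_mem_unitBall,
    Measure.quasiMeasurePreserving_snd.ae ae_mem_unitBall,
    Measure.quasiMeasurePreserving_fst.ae (ae_ballMeasure_inner_ne_zero hν),
    Measure.quasiMeasurePreserving_snd.ae (ae_ballMeasure_inner_ne_zero hν)]
    with z hne hne' h1 h2 hz1 hz2
  exact symmetrisedDensity_polarise hd hν f h1 h2 hne hne' hz1 hz2

lemma polarise_nonneg {f : EuclideanSpace ℝ (Fin d) → ℝ} (hf0 : ∀ x, 0 ≤ f x)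
    (x : EuclideanSpace ℝ (Fin d)) : 0 ≤ polarise ν f x := by
  unfold polarise
  split_ifs
  · exact le_min (hf0 _) (hf0 _)
  · exact le_max_of_le_left (hf0 _)

lemma J_le_J_polarise (hd : 1 ≤ d) (hν : ‖ν‖ = 1) {f : EuclideanSpace ℝ (Fin d) → ℝ}
    (hf : Measurable f) (hf0 : ∀ x, 0 ≤ f x) : J f ≤ J (polarise ν f) := by
  have h : 4 * J f ≤ 4 * J (polarise ν f) := by
    rw [← lintegral_symmetrisedDensity hν hf hf0,
      ← lintegral_symmetrisedDensity hν (measurable_polarise hf) (polarise_nonneg hf0)]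
    exact lintegral_mono_ae ((ae_symmetrisedDensity_polarise hd hν f).mono
      fun z hz => ENNReal.ofReal_le_ofReal hz.1)
  exact (ENNReal.mul_le_mul_iff_right (by norm_num) (by norm_num)).mp h

/-- If a property holds almost everywhere on the negative side of the hyperplane, then almost
every point or its reflection is on the negative side and has the property. -/
lemma ae_neg_side_or_reflect (hν : ‖ν‖ = 1) {p : EuclideanSpace ℝ (Fin d) → Prop}
    (h : ∀ᵐ x ∂(ballMeasure d), inner ℝ x ν < 0 → p x) :
    ∀ᵐ x ∂(ballMeasure d), inner ℝ x ν < 0 ∧ p x ∨ 0 < inner ℝ x ν ∧ p (reflect ν x) := by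
  filter_upwards [h, (measurePreserving_reflect hν).quasiMeasurePreserving.ae h,
    ae_ballMeasure_inner_ne_zero hν] with x h1 h2 h3
  rcases lt_or_gt_of_ne h3 with hx | hx
  · exact .inl ⟨hx, h1 hx⟩
  · exact .inr ⟨hx, h2 (by rw [inner_reflect hν]; linarith)⟩

lemma ae_eq_polarise_of_J_eq (hd : 1 ≤ d) (hν : ‖ν‖ = 1) {f : EuclideanSpace ℝ (Fin d) → ℝ}
    (hf : Measurable f) (hf0 : ∀ x, 0 ≤ f x) (hfin : J f < ⊤) (heq : J f = J (polarise ν f)) :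
    (∀ᵐ x ∂(ballMeasure d), f x = polarise ν f x) ∨
      ∀ᵐ x ∂(ballMeasure d), f (reflect ν x) = polarise ν f x := by
  have hP := ae_symmetrisedDensity_polarise hd hν f
  -- Finiteness enters here: ordered densities with equal finite integrals agree a.e.
  have hmain := ae_eq_of_ae_le_of_lintegral_le
    (hP.mono fun z hz => ENNReal.ofReal_le_ofReal hz.1)
    (by rw [lintegral_symmetrisedDensity hν hf hf0]
        exact ENNReal.mul_ne_top (by norm_num) hfin.ne)
    (measurable_symmetrisedDensity (measurable_polarise hf)).ennreal_ofReal.aemeasurable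
    (by rw [lintegral_symmetrisedDensity hν hf hf0, lintegral_symmetrisedDensity hν
          (measurable_polarise hf) (polarise_nonneg hf0), heq])
  have hsign : ∀ᵐ z ∂((ballMeasure d).prod (ballMeasure d)), inner ℝ z.1 ν < 0 →
      inner ℝ z.2 ν < 0 → 0 ≤ (f z.1 - f (reflect ν z.1)) * (f z.2 - f (reflect ν z.2)) := by
    filter_upwards [hP, hmain] with z hz hz' h1 h2
    exact hz.2 h1 h2 ((ENNReal.ofReal_eq_ofReal_iff (symmetrisedDensity_nonneg hf0 z)
      (symmetrisedDensity_nonneg (polarise_nonneg hf0) z)).mp hz')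
  have hprod : (ballMeasure d).prod (ballMeasure d)
      ({x | inner ℝ x ν < 0 ∧ f (reflect ν x) < f x} ×ˢ
        {x | inner ℝ x ν < 0 ∧ f x < f (reflect ν x)}) = 0 := by
    refine measure_mono_null ?_ (ae_iff.mp hsign)
    rintro ⟨x, y⟩ ⟨⟨hx, hx'⟩, hy, hy'⟩ h
    exact absurd (h hx hy) (mul_neg_of_pos_of_neg (sub_pos.mpr hx') (sub_neg.mpr hy')).not_ge
  rw [Measure.prod_prod, mul_eq_zero] at hprod
  rcases hprod with h0 | h0
  -- On the negative side `f ≤ f ∘ τ` a.e. and polarisation takes the maximum, which is `f ∘ τ`.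
  · right
    have h : ∀ᵐ x ∂(ballMeasure d), inner ℝ x ν < 0 → f x ≤ f (reflect ν x) := by
      rw [ae_iff]
      simpa using h0
    filter_upwards [ae_neg_side_or_reflect hν h] with x hx
    rcases hx with ⟨hx, hle⟩ | ⟨hx, hle⟩
    · rw [polarise_of_neg hx, max_eq_right hle]
    · rw [reflect_reflect hν] at hle
      rw [polarise_of_pos hx, min_eq_right hle]
  · left
    have h : ∀ᵐ x ∂(ballMeasure d), inner ℝ x ν < 0 → f (reflect ν x) ≤ f x := by
      rw [ae_iff]
      simpa using h0
    filter_upwards [ae_neg_side_or_reflect hν h] with x hx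
    rcases hx with ⟨hx, hle⟩ | ⟨hx, hle⟩
    · rw [polarise_of_neg hx, max_eq_left hle]
    · rw [reflect_reflect hν] at hle
      rw [polarise_of_pos hx, min_eq_left hle]

end Energy

end BallPolarisation

theorem mainTheorem5 (d : ℕ) (hd : 1 ≤ d)
    (ν : EuclideanSpace ℝ (Fin d)) (hν : ‖ν‖ = 1)
    (f : EuclideanSpace ℝ (Fin d) → ℝ)
    (hf : Integrable f (BallPolarisation.ballMeasure d))
    (hf0 : ∀ᵐ x ∂(BallPolarisation.ballMeasure d), 0 ≤ f x) :
    BallPolarisation.J f ≤ BallPolarisation.J (BallPolarisation.polarise ν f) ∧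
    (((∀ᵐ x ∂(BallPolarisation.ballMeasure d), f x = BallPolarisation.polarise ν f x) ∨
      (∀ᵐ x ∂(BallPolarisation.ballMeasure d),
        f (BallPolarisation.reflect ν x) = BallPolarisation.polarise ν f x)) →
      BallPolarisation.J f = BallPolarisation.J (BallPolarisation.polarise ν f)) ∧
    (BallPolarisation.J f < ⊤ →
      BallPolarisation.J f = BallPolarisation.J (BallPolarisation.polarise ν f) →
      ((∀ᵐ x ∂(BallPolarisation.ballMeasure d), f x = BallPolarisation.polarise ν f x) ∨
      (∀ᵐ x ∂(BallPolarisation.ballMeasure d),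
        f (BallPolarisation.reflect ν x) = BallPolarisation.polarise ν f x))) := by
  -- Passes to a measurable, everywhere nonnegative representative; `J` and polarisation respect
  -- a.e. equality.
  obtain ⟨g, hgm, hg0, hfg⟩ : ∃ g : EuclideanSpace ℝ (Fin d) → ℝ, Measurable g ∧ (∀ x, 0 ≤ g x) ∧
      f =ᵐ[BallPolarisation.ballMeasure d] g := by
    have hfm := hf.aestronglyMeasurable.aemeasurable
    refine ⟨fun x => max (hfm.mk f x) 0, hfm.measurable_mk.max measurable_const,
      fun x => le_max_right _ _, ?_⟩
    filter_upwards [hfm.ae_eq_mk, hf0] with x hx hx0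
    rw [← hx, max_eq_left hx0]
  have hpol := BallPolarisation.polarise_congr_ae hν hfg
  have hτ := (BallPolarisation.measurePreserving_reflect hν).quasiMeasurePreserving.ae hfg
  rw [BallPolarisation.J_congr_ae hfg, BallPolarisation.J_congr_ae hpol]
  refine ⟨BallPolarisation.J_le_J_polarise hd hν hgm hg0, ?_, fun hfin heq => ?_⟩
  · rintro (h | h)
    · refine BallPolarisation.J_congr_ae ?_
      filter_upwards [hfg, hpol, h] with x h1 h2 h3
      rw [← h1, h3, h2]
    · rw [← BallPolarisation.J_comp_reflect hν hgm]
      refine BallPolarisation.J_congr_ae ?_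
      filter_upwards [hτ, hpol, h] with x h1 h2 h3
      rw [← h1, h3, h2]
  · refine (BallPolarisation.ae_eq_polarise_of_J_eq hd hν hgm hg0 hfin heq).imp
      (fun h => ?_) (fun h => ?_)
    · filter_upwards [hfg, hpol, h] with x h1 h2 h3
      rw [h1, h3, h2]
    · filter_upwards [hτ, hpol, h] with x h1 h2 h3
      rw [h1, h3, h2]
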